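/- Let $\mathbf{k}=(3,3,3,3,3,3)$, i.e. forbid a monochromatic triangle in each of six colours. Let $\mathrm{feas}^*(\mathbf{k})$ be the set of all triples $(r,\phi,\alpha)$ where - $r\ge 1$ is an integer; - $\phi:\binom{[r]}{2}\to 2^{[6]}$ satisfies $|\phi(ij)|\ge 2$ for every pair $ij\in\binom{[r]}{2}$, and for each colour $c\in[6]$ the graph $\phi^{-1}(c):=\{ij\in\binom{[r]}{2}: c\in\phi(ij)\}$ on vertex set $[r]$ is triangle-free; - $\alpha=(\alpha_1,\dots,\alpha_r)\in\mathbb{R}^r$ satisfies $\alpha_i>0$ for all $i$ and $\alpha_1+\dots+\alpha_r=1$. For such a triple put $q(\phi,\alpha):=2\sum_{1\le i<j\le r}\alpha_i\alpha_j\log_2|\phi(ij)|$. A triple in $\mathrm{feas}^*(\mathbf{k})$ is called optimal if it maximises $q$ over $\mathrm{feas}^*(\mathbf{k})$. Then the maximum $Q(\mathbf{k}):=\max_{(r,\phi,\alpha)\in\mathrm{feas}^*(\mathbf{k})}q(\phi,\alpha)$ exists and equals $\tfrac12\log_2 3+\tfrac34$, and every optimal triple $(r,\phi,\alpha)$ satisfies: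 $r=8$; $\alpha$ is uniform, i.e. $\alpha_i=\tfrac18$ for all $i\in[8]$; $|\phi(ij)|\in\{3,4\}$ for all $ij\in\binom{[8]}{2}$; the graph $\{ij\in\binom{[8]}{2}:|\phi(ij)|=3\}$ on $[8]$ is isomorphic to $K_{4,4}$; and $\phi^{-1}(c)\cong K_{4,4}$ for every $c\in[6]$. -/

import Mathlib

namespace ErdosRothschild

/-- The data `(r, φ, α)` of a candidate for Problem `Q*` with `s` colours. The vertex set is `Fin r`
and the value of `φ` at an unordered pair `ij` of distinct vertices is `φ s(i, j)`. Only these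
off-diagonal values of `φ` are ever used. -/
structure Triple (s : ℕ) where
  /-- the number of vertices -/
  r : ℕ
  /-- the colour pattern -/
  φ : Sym2 (Fin r) → Finset (Fin s)
  /-- the vertex weighting -/
  α : Fin r → ℝ

namespace Triple

variable {s : ℕ}

/-- The colour graph `φ⁻¹(c)`: `ij` is an edge iff `i ≠ j` and `c ∈ φ(ij)`. -/
def colourGraph (T : Triple s) (c : Fin s) : SimpleGraph (Fin T.r) :=
  SimpleGraph.fromEdgeSet {e | c ∈ T.φ e}

/-- The graph of all pairs `ij`, `i ≠ j`, with `|φ(ij)| = t`. -/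
def multiplicityGraph (T : Triple s) (t : ℕ) : SimpleGraph (Fin T.r) :=
  SimpleGraph.fromEdgeSet {e | (T.φ e).card = t}

/-- `q(φ, α) = 2 ∑_{i < j} α_i α_j log₂ |φ(ij)|`. -/
noncomputable def q (T : Triple s) : ℝ :=
  2 * ∑ i : Fin T.r, ∑ j ∈ Finset.univ.filter (fun j => i < j),
    T.α i * T.α j * Real.logb 2 ((T.φ s(i, j)).card : ℝ)

end Triple

/-- Feasible triples for Problem `Q*`. The two conditions on the weights force `r ≥ 1`. -/
structure IsFeasible {s : ℕ} (k : Fin s → ℕ) (T : Triple s) : Prop where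
  cliqueFree : ∀ c, (T.colourGraph c).CliqueFree (k c)
  two_le_card : ∀ i j, i ≠ j → 2 ≤ (T.φ s(i, j)).card
  weight_pos : ∀ i, 0 < T.α i
  weight_sum : ∑ i, T.α i = 1

/-- The set of feasible triples. -/
def feas {s : ℕ} (k : Fin s → ℕ) : Set (Triple s) := {T | IsFeasible k T}

/-- The set of optimal triples: feasible triples at which `q` attains its maximum over all
feasible triples. -/
def opt {s : ℕ} (k : Fin s → ℕ) : Set (Triple s) :=
  {T | T ∈ feas k ∧ ∀ T' ∈ feas k, T'.q ≤ T.q}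

end ErdosRothschild

/-! Write m for the multiplicity of a pair (0 on the diagonal). The quadratic through (0, 0), (3,
log₂ 3), (4, 2) dominates log₂ m for 1 ≤ m ≤ 6 (`logb_le_quadratic`), so `q` is at most a
combination of the first two moments of m over an `α`-random pair. The first moment is the sum of
the colour densities; the second is the sum of all codensities. Since the leading coefficient is
negative, codensities must be bounded below and densities above.

The key inequality is `two_graph_density`: triangle-free graphs of densities a, b overlap in density
at least 5(a + b)/4 - 1. Zykov symmetrisation reduces it to weights supported on a clique of the
union, which has at most 5 vertices because R(3,3) = 6, and at most 4 if an edge is shared. With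
Mantel's bound a ≤ 1/2, this makes the distance of `q` from the claimed maximum a sum of nonnegative
slacks (`deficit_eq`). A binary [6,3,3] code attains the maximum.

At equality every slack vanishes: multiplicities are 3 or 4, each colour is a balanced cut, and
distinct cuts are orthogonal. Every vertex then sees the same two moments of m, and averaging (m -
3)(m - 4), which is nonzero only at the vertex itself, yields its weight 1/8. The pairs of
multiplicity 3 form a cut by parity, since each colour meets a triangle in an even number of edges.
-/

namespace ErdosRothschild

open Finset Matrix

/-! ### Zykov symmetrisation for quadratic forms. -/

section Zykov

variable {V : Type*} [Fintype V] [DecidableEq V]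

/-- A quadratic form is affine along the exchange direction of two indices that do not interact. -/
theorem quadForm_shift (W : Matrix V V ℝ) (x : V → ℝ) {i j : V} (hii : W i i = 0) (hjj : W j j = 0)
    (hij : W i j = 0) (hji : W j i = 0) (t : ℝ) :
    (x + t • (Pi.single i 1 - Pi.single j 1)) ⬝ᵥ
        (W *ᵥ (x + t • (Pi.single i 1 - Pi.single j 1))) =
      x ⬝ᵥ (W *ᵥ x) + t * (x ⬝ᵥ (W *ᵥ (Pi.single i 1 - Pi.single j 1)) +
        (Pi.single i 1 - Pi.single j 1) ⬝ᵥ (W *ᵥ x)) := by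
  have h : (Pi.single i 1 - Pi.single j 1 : V → ℝ) ⬝ᵥ
      (W *ᵥ (Pi.single i 1 - Pi.single j 1)) = 0 := by
    simp [mulVec_sub, sub_dotProduct, hii, hjj, hij, hji]
  rw [mulVec_add, mulVec_smul, add_dotProduct, dotProduct_add, dotProduct_add, smul_dotProduct,
    dotProduct_smul, smul_dotProduct, dotProduct_smul, h]
  simp only [smul_eq_mul]
  ring

/-- Symmetrisation: a quadratic bound on the nonnegative orthant need only be checked at vectors
whose support is a clique in the graph of nonzero entries. -/
theorem quadForm_le_of_clique_support (W : Matrix V V ℝ) (hW : ∀ i j, W i j = W j i)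
    (hdiag : ∀ i, W i i = 0) (K : ℝ)
    (hclique : ∀ x : V → ℝ, (∀ i, 0 ≤ x i) →
      (∀ i j, x i ≠ 0 → x j ≠ 0 → i ≠ j → W i j ≠ 0) → x ⬝ᵥ (W *ᵥ x) ≤ K * (∑ i, x i) ^ 2)
    (x : V → ℝ) (hx : ∀ i, 0 ≤ x i) : x ⬝ᵥ (W *ᵥ x) ≤ K * (∑ i, x i) ^ 2 := by
  induction hn : #{i | x i ≠ 0} using Nat.strong_induction_on generalizing x with
  | _ n ih =>
    by_cases hc : ∀ i j, x i ≠ 0 → x j ≠ 0 → i ≠ j → W i j ≠ 0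
    · exact hclique x hx hc
    push Not at hc
    obtain ⟨i, j, hi, hj, hij, hw⟩ := hc
    have hi' : 0 < x i := lt_of_le_of_ne (hx i) (Ne.symm hi)
    have hj' : 0 < x j := lt_of_le_of_ne (hx j) (Ne.symm hj)
    -- Moving all of the weight of `j` onto `i` shrinks the support, so induction applies. The form
    -- is affine along this line, hence one of the two opposite moves does not decrease it.
    have key : ∀ i j : V, i ≠ j → x i ≠ 0 → x j ≠ 0 →
        (x + x j • (Pi.single i 1 - Pi.single j 1)) ⬝ᵥ
        (W *ᵥ (x + x j • (Pi.single i 1 - Pi.single j 1))) ≤ K * (∑ i, x i) ^ 2 := by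
      intro i j hij hi hj
      have hnn : ∀ k, 0 ≤ (x + x j • (Pi.single i 1 - Pi.single j 1) : V → ℝ) k := by
        intro k
        rcases eq_or_ne k j with rfl | hkj
        · simp [hij.symm]
        · simp only [Pi.add_apply, Pi.smul_apply, Pi.sub_apply, Pi.single_apply, hkj, smul_eq_mul,
            if_false, sub_zero]
          split_ifs
          · linarith [hx k, hx j]
          · linarith [hx k]
      have hsum : ∑ k, (x + x j • (Pi.single i 1 - Pi.single j 1) : V → ℝ) k = ∑ k, x k := by
        simp [Finset.sum_add_distrib, ← Finset.mul_sum]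
      have hlt : #{k | (x + x j • (Pi.single i 1 - Pi.single j 1) : V → ℝ) k ≠ 0} < n := by
        rw [← hn]
        apply Finset.card_lt_card
        refine ⟨fun k hk => ?_, fun hsub => ?_⟩
        · simp only [mem_filter, mem_univ, true_and] at hk ⊢
          intro hk0
          apply hk
          have h1 : k ≠ i := by rintro rfl; exact hi hk0
          have h2 : k ≠ j := by rintro rfl; exact hj hk0
          simp [h1, h2, hk0]
        · have := hsub (show j ∈ _ by simpa using hj)
          simp [hij.symm] at this
      simpa only [hsum] using ih _ hlt _ hnn rfl
    have h1 := key i j hij hi hj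
    have h2 := key j i hij.symm hj hi
    rw [quadForm_shift W x (hdiag _) (hdiag _) hw (by rw [hW, hw])] at h1
    rw [quadForm_shift W x (hdiag _) (hdiag _) (by rw [hW, hw]) hw] at h2
    rw [← neg_sub (Pi.single i 1 : V → ℝ) (Pi.single j 1), mulVec_neg, dotProduct_neg,
      neg_dotProduct] at h2
    set b := x ⬝ᵥ (W *ᵥ (Pi.single i 1 - Pi.single j 1)) +
        (Pi.single i 1 - Pi.single j 1) ⬝ᵥ (W *ᵥ x) with hb
    rcases le_total 0 b with h | h
    · nlinarith
    · have h3 := mul_nonneg hi'.le (neg_nonneg.2 h)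
      have h4 : -(x ⬝ᵥ (W *ᵥ (Pi.single i 1 - Pi.single j 1))) +
        -((Pi.single i 1 - Pi.single j 1) ⬝ᵥ (W *ᵥ x)) = -b := by rw [hb]; ring
      rw [h4] at h2
      linarith

end Zykov

/-! ### Overlap of two triangle-free graphs. -/

section TwoGraphs

variable {V : Type*}

theorem no_triangle {G : SimpleGraph V} (hG : G.CliqueFree 3) {a b c : V}
    (hab : G.Adj a b) (hac : G.Adj a c) (hbc : G.Adj b c) : False := by
  classical
  exact hG {a, b, c} (SimpleGraph.is3Clique_triple_iff.2 ⟨hab, hac, hbc⟩)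

/-- The 0-1 indicator of adjacency. -/
noncomputable def adjInd (G : SimpleGraph V) (i j : V) : ℝ :=
  open Classical in if G.Adj i j then 1 else 0

theorem adjInd_comm (G : SimpleGraph V) (i j : V) : adjInd G i j = adjInd G j i := by
  classical
  unfold adjInd
  exact if_congr (G.adj_comm i j) rfl rfl

/-- A set covered by two triangle-free graphs and containing an edge common to both has at most
four elements. -/
theorem card_le_four_of_common_edge {G H : SimpleGraph V} (hG : G.CliqueFree 3)
    (hH : H.CliqueFree 3) {S : Finset V}
    (hS : ∀ i ∈ S, ∀ j ∈ S, i ≠ j → G.Adj i j ∨ H.Adj i j) {i j : V} (hi : i ∈ S) (hj : j ∈ S)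
    (hGij : G.Adj i j) (hHij : H.Adj i j) : #S ≤ 4 := by
  classical
  by_contra! hcard
  have hR : 1 * 2 < #((S.erase i).erase j) := by
    rw [card_erase_of_mem (mem_erase.2 ⟨hGij.ne.symm, hj⟩), card_erase_of_mem hi]; omega
  have hmap : ∀ k ∈ (S.erase i).erase j, decide (G.Adj i k) ∈ (univ : Finset Bool) :=
    fun _ _ => mem_univ _
  obtain ⟨t, -, ht⟩ := exists_lt_card_fiber_of_mul_lt_card_of_maps_to hmap
    (n := 1) (by simpa using hR)
  obtain ⟨k, hk, l, hl, hkl⟩ := one_lt_card.1 ht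
  simp only [mem_filter, mem_erase] at hk hl
  -- Two vertices `k`, `l` of the same type lead to a contradiction: each graph already joins both
  -- of them to `i` or to `j`, so whichever one contains `kl` has a triangle.
  have dich : ∀ k, k ≠ i → k ≠ j → k ∈ S →
      (G.Adj i k ∧ H.Adj j k) ∨ (¬ G.Adj i k ∧ H.Adj i k ∧ G.Adj j k) := by
    intro k hki hkj hk
    by_cases h : G.Adj i k
    · exact Or.inl ⟨h, (hS j hj k hk hkj.symm).resolve_left fun h' => no_triangle hG hGij h h'⟩
    · have h' := (hS i hi k hk hki.symm).resolve_left h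
      exact Or.inr ⟨h, h', (hS j hj k hk hkj.symm).resolve_right fun h'' =>
        no_triangle hH hHij h' h''⟩
  have hkk := dich k hk.1.2.1 hk.1.1 hk.1.2.2
  have hll := dich l hl.1.2.1 hl.1.1 hl.1.2.2
  have hiff : G.Adj i k ↔ G.Adj i l := by rw [← decide_eq_decide, hk.2, hl.2]
  rcases hkk with ⟨a, b⟩ | ⟨a, b, c⟩ <;> rcases hll with ⟨a', b'⟩ | ⟨a', b', c'⟩
  · exact (hS k hk.1.2.2 l hl.1.2.2 hkl).elim (no_triangle hG a a') (no_triangle hH b b')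
  · exact a' (hiff.1 a)
  · exact a (hiff.2 a')
  · exact (hS k hk.1.2.2 l hl.1.2.2 hkl).elim (no_triangle hG c c') (no_triangle hH b b')

/-- A set covered by two triangle-free graphs has at most five elements. -/
theorem card_le_five_of_cover {G H : SimpleGraph V} (hG : G.CliqueFree 3)
    (hH : H.CliqueFree 3) {S : Finset V}
    (hS : ∀ i ∈ S, ∀ j ∈ S, i ≠ j → G.Adj i j ∨ H.Adj i j) : #S ≤ 5 := by
  classical
  by_contra! hcard
  obtain ⟨i, hi⟩ : S.Nonempty := card_pos.1 (by omega)
  -- `G`-neighbours of `i` are pairwise joined in `H`, so there are at most two; likewise with the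
  -- graphs exchanged. This leaves at most 1 + 2 + 2 vertices.
  have aux : ∀ {G H : SimpleGraph V}, G.CliqueFree 3 → H.CliqueFree 3 →
      (∀ i ∈ S, ∀ j ∈ S, i ≠ j → G.Adj i j ∨ H.Adj i j) →
      ∀ R ⊆ S, (∀ k ∈ R, G.Adj i k) → #R ≤ 2 := by
    intro G H hG hH hS R hRS hR
    by_contra! h
    obtain ⟨a, ha, b, hb, c, hc, hab, hac, hbc⟩ := two_lt_card.1 h
    have hh : ∀ a ∈ R, ∀ b ∈ R, a ≠ b → H.Adj a b := fun a ha b hb hab =>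
      (hS a (hRS ha) b (hRS hb) hab).resolve_left (no_triangle hG (hR a ha) (hR b hb))
    exact no_triangle hH (hh a ha b hb hab) (hh a ha c hc hac) (hh b hb c hc hbc)
  have h1 := aux hG hH hS {k ∈ S.erase i | G.Adj i k}
    ((filter_subset _ _).trans (erase_subset _ _)) (by simp)
  have h2 := aux hH hG (fun i hi j hj hij => (hS i hi j hj hij).symm)
    {k ∈ S.erase i | ¬ G.Adj i k} ((filter_subset _ _).trans (erase_subset _ _)) (by
      intro k hk
      simp only [mem_filter, mem_erase] at hk
      exact (hS i hi k hk.1.2 hk.1.1.symm).resolve_left hk.2)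
  have h3 := card_filter_add_card_filter_not (s := S.erase i) (fun k => G.Adj i k)
  rw [card_erase_of_mem hi] at h3
  omega

/-- A symmetric relation in which every element has at most one partner contributes at most the
sum of squares. -/
theorem sum_matching_le [Fintype V] (x : V → ℝ) (D : V → V → Prop) [DecidableRel D]
    (hD : ∀ i j, D i j → D j i) (huniq : ∀ i j k, D i j → D i k → j = k) :
    ∑ i, ∑ j, (if D i j then x i * x j else 0) ≤ ∑ i, x i ^ 2 := by
  have hrow : ∀ i, ∑ j, (if D i j then x i ^ 2 else 0) ≤ x i ^ 2 := by
    intro i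
    by_cases h : ∃ j, D i j
    · obtain ⟨j, hj⟩ := h
      rw [Finset.sum_eq_single j]
      · simp [hj]
      · intro k _ hk
        exact if_neg fun h => hk (huniq i k j h hj)
      · simp
    · push Not at h
      simp [h, sq_nonneg]
  have hswap : ∑ i, ∑ j, (if D i j then x j ^ 2 else 0) =
      ∑ i, ∑ j, (if D i j then x i ^ 2 else 0) := by
    rw [Finset.sum_comm]
    refine sum_congr rfl fun i _ => sum_congr rfl fun j _ => ?_
    have : D j i ↔ D i j := ⟨hD _ _, hD _ _⟩
    simp [this]
  have hle : 2 * ∑ i, ∑ j, (if D i j then x i * x j else 0) ≤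
      ∑ i, ∑ j, (if D i j then x i ^ 2 else 0) + ∑ i, ∑ j, (if D i j then x j ^ 2 else 0) := by
    simp only [Finset.mul_sum, ← Finset.sum_add_distrib]
    refine sum_le_sum fun i _ => sum_le_sum fun j _ => ?_
    split_ifs
    · nlinarith [sq_nonneg (x i - x j)]
    · simp
  have := sum_le_sum fun i (_ : i ∈ univ) => hrow i
  linarith

/-- For two weighted triangle-free graphs of densities `a`, `b` whose intersection has density `p`,
`5 (a + b) - 4 p ≤ 4`. -/
theorem two_graph_density [Fintype V] {G H : SimpleGraph V} (hG : G.CliqueFree 3) (hH : H.CliqueFree 3)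
    (α : V → ℝ) (hα : ∀ i, 0 ≤ α i) :
    ∑ i, ∑ j, α i * α j * (5 * (adjInd G i j + adjInd H i j) - 4 * (adjInd G i j * adjInd H i j)) ≤
      4 * (∑ i, α i) ^ 2 := by
  classical
  set W : Matrix V V ℝ := Matrix.of fun i j =>
    5 * (adjInd G i j + adjInd H i j) - 4 * (adjInd G i j * adjInd H i j) with hWdef
  have hform : ∀ x : V → ℝ, x ⬝ᵥ (W *ᵥ x) = ∑ i, ∑ j, x i * x j * W i j := by
    intro x
    simp only [dotProduct, mulVec, Finset.mul_sum]
    exact sum_congr rfl fun i _ => sum_congr rfl fun j _ => by ring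
  have hW0 : ∀ i j, W i j ≠ 0 → G.Adj i j ∨ H.Adj i j := by
    intro i j h
    by_contra! h'
    simp [hWdef, adjInd, h'.1, h'.2] at h
  have := quadForm_le_of_clique_support W
    (fun i j => by simp only [hWdef, of_apply, adjInd_comm _ i j])
    (fun i => by simp [hWdef, adjInd]) 4 ?_ α hα
  · rwa [hform] at this
  intro x hx hcl
  rw [hform]
  set S : Finset V := {i | x i ≠ 0} with hSdef
  have hmem : ∀ {i}, i ∈ S ↔ x i ≠ 0 := by simp [hSdef]
  have hS : ∀ i ∈ S, ∀ j ∈ S, i ≠ j → G.Adj i j ∨ H.Adj i j := fun i hi j hj hij =>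
    hW0 i j (hcl i j (hmem.1 hi) (hmem.1 hj) hij)
  have hsumS : ∑ i ∈ S, x i = ∑ i, x i :=
    sum_subset (subset_univ _) fun i _ hi => not_not.1 (mt hmem.2 hi)
  have hsqS : ∑ i ∈ S, x i ^ 2 = ∑ i, x i ^ 2 :=
    sum_subset (subset_univ _) fun i _ hi => by rw [not_not.1 (mt hmem.2 hi)]; simp
  have hCS : (∑ i, x i) ^ 2 ≤ #S * ∑ i, x i ^ 2 := by
    rw [← hsumS, ← hsqS]; exact sq_sum_le_card_mul_sum_sq
  have hnn : 0 ≤ ∑ i, x i ^ 2 := sum_nonneg fun i _ => sq_nonneg _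
  set D : V → V → Prop := fun i j => i ∈ S ∧ j ∈ S ∧ G.Adj i j ∧ H.Adj i j with hDdef
  -- On a clique of the union, an edge of exactly one graph weighs 5 and a common edge 5 + 5 - 4 =
  -- 6.
  have hexp : ∑ i, ∑ j, x i * x j * W i j = 5 * ((∑ i, x i) ^ 2 - ∑ i, x i ^ 2) +
      ∑ i, ∑ j, (if D i j then x i * x j else 0) := by
    have hdiag : ∑ i, x i ^ 2 = ∑ i, ∑ j, (if i = j then x i * x j else 0) := by
      simp [sq]
    rw [hdiag, sq, Finset.sum_mul_sum, ← Finset.sum_sub_distrib, Finset.mul_sum,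
      ← Finset.sum_add_distrib]
    refine sum_congr rfl fun i _ => ?_
    rw [← Finset.sum_sub_distrib, Finset.mul_sum, ← Finset.sum_add_distrib]
    refine sum_congr rfl fun j _ => ?_
    by_cases hi : i ∈ S
    swap
    · simp [not_not.1 (mt hmem.2 hi)]
    by_cases hj : j ∈ S
    swap
    · simp [not_not.1 (mt hmem.2 hj)]
    by_cases hij : i = j
    · subst hij
      simp [hWdef, adjInd, hDdef]
    have hc := hS i hi j hj hij
    simp only [hWdef, of_apply, adjInd, hDdef, hi, hj, hij, true_and, if_false]
    by_cases h1 : G.Adj i j <;> by_cases h2 : H.Adj i j <;> simp [h1, h2] at hc ⊢ <;> ring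
  rw [hexp]
  -- With s = ∑ x and Q = ∑ x², common edges form a matching and add at most Q, while s² ≤ 4Q, so
  -- the form is at most 5s² - 4Q ≤ 4s². Without common edges it is 5s² - 5Q, and s² ≤ 5Q suffices.
  by_cases hne : ∃ i j, D i j
  · obtain ⟨i, j, hi, hj, hGij, hHij⟩ := hne
    have h4 : (#S : ℝ) ≤ 4 := by
      exact_mod_cast card_le_four_of_common_edge hG hH hS hi hj hGij hHij
    have hm := sum_matching_le x D
      (fun i j h => ⟨h.2.1, h.1, h.2.2.1.symm, h.2.2.2.symm⟩) (by
        rintro i j k ⟨_, hj, h1, h2⟩ ⟨_, hk, h3, h4⟩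
        by_contra hjk
        exact (hS j hj k hk hjk).elim (no_triangle hG h1 h3) (no_triangle hH h2 h4))
    nlinarith
  · push Not at hne
    have h5 : (#S : ℝ) ≤ 5 := by exact_mod_cast card_le_five_of_cover hG hH hS
    simp only [hne, if_false, sum_const_zero]
    nlinarith

end TwoGraphs

end ErdosRothschild

namespace ErdosRothschild

open Finset Matrix

/-! ### Weighted Mantel theorem, its equality case, and orthogonal cuts. -/

section Mantel

variable {V : Type*} {G H : SimpleGraph V}

theorem adjInd_of_adj {i j : V} (h : G.Adj i j) : adjInd G i j = 1 := by simp [adjInd, h]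

theorem adjInd_of_not_adj {i j : V} (h : ¬ G.Adj i j) : adjInd G i j = 0 := by simp [adjInd, h]

theorem adjInd_add_le_one (hG : G.CliqueFree 3) {i j : V} (h : G.Adj i j) (k : V) :
    adjInd G i k + adjInd G j k ≤ 1 := by
  by_cases h1 : G.Adj i k <;> by_cases h2 : G.Adj j k
  · exact (no_triangle hG h h1 h2).elim
  all_goals simp [adjInd, h1, h2]

variable [Fintype V]

/-- The weighted degree of a vertex. -/
noncomputable def wdeg (G : SimpleGraph V) (α : V → ℝ) (i : V) : ℝ := ∑ j, α j * adjInd G i j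

/-- The density of a weighted graph: the probability that two independent `α`-random vertices are
adjacent. -/
noncomputable def density (G : SimpleGraph V) (α : V → ℝ) : ℝ :=
  ∑ i, ∑ j, α i * α j * adjInd G i j

/-- The density of the pairs adjacent in both graphs. -/
noncomputable def coDensity (G H : SimpleGraph V) (α : V → ℝ) : ℝ :=
  ∑ i, ∑ j, α i * α j * (adjInd G i j * adjInd H i j)

variable {α : V → ℝ}

theorem density_eq_sum_wdeg (G : SimpleGraph V) (α : V → ℝ) :
    density G α = ∑ i, α i * wdeg G α i := by
  simp only [density, wdeg, Finset.mul_sum, mul_assoc]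

theorem coDensity_self (G : SimpleGraph V) (α : V → ℝ) : coDensity G G α = density G α := by
  refine sum_congr rfl fun i _ => sum_congr rfl fun j _ => ?_
  by_cases h : G.Adj i j <;> simp [adjInd, h]

theorem coDensity_lower (hG : G.CliqueFree 3) (hH : H.CliqueFree 3) (hα : ∀ i, 0 ≤ α i)
    (hsum : ∑ i, α i = 1) : 5 / 4 * (density G α + density H α) - 1 ≤ coDensity G H α := by
  have h := two_graph_density hG hH α hα
  have h' : ∑ i, ∑ j, α i * α j *
      (5 * (adjInd G i j + adjInd H i j) - 4 * (adjInd G i j * adjInd H i j)) =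
      5 * (density G α + density H α) - 4 * coDensity G H α := by
    simp only [density, coDensity, ← Finset.sum_add_distrib, Finset.mul_sum,
      ← Finset.sum_sub_distrib]
    exact sum_congr rfl fun i _ => sum_congr rfl fun j _ => by ring
  rw [h', hsum] at h
  linarith

theorem wdeg_add_le_one (hG : G.CliqueFree 3) (hα : ∀ i, 0 ≤ α i) (hsum : ∑ i, α i = 1) {i j : V}
    (h : G.Adj i j) : wdeg G α i + wdeg G α j ≤ 1 := by
  rw [wdeg, wdeg, ← Finset.sum_add_distrib, ← hsum]
  refine sum_le_sum fun k _ => ?_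
  nlinarith [hα k, adjInd_add_le_one hG h k]

/-- Mantel's theorem for weighted graphs, with the variance of the degrees as an error term. -/
theorem mantel_variance (hG : G.CliqueFree 3) (hα : ∀ i, 0 ≤ α i) (hsum : ∑ i, α i = 1) :
    ∑ i, α i * (wdeg G α i - 1 / 2) ^ 2 ≤ 1 / 2 * (1 / 2 - density G α) := by
  set d := wdeg G α with hd
  -- Summing the edge bound d i + d j ≤ 1 gives 2 ∑ α d² ≤ density.
  have h1 : ∑ i, ∑ j, α i * α j * adjInd G i j * (d i + d j) ≤ density G α := by
    refine sum_le_sum fun i _ => sum_le_sum fun j _ => ?_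
    by_cases h : G.Adj i j
    · have := wdeg_add_le_one hG hα hsum h
      rw [adjInd_of_adj h]
      nlinarith [mul_nonneg (hα i) (hα j)]
    · simp [adjInd_of_not_adj h]
  have h2 : ∑ i, ∑ j, α i * α j * adjInd G i j * d i = ∑ i, α i * d i ^ 2 := by
    refine sum_congr rfl fun i _ => ?_
    rw [sq, ← mul_assoc, hd]
    conv_rhs => arg 2; rw [wdeg]
    rw [Finset.mul_sum]
    exact sum_congr rfl fun j _ => by ring
  have h3 : ∑ i, ∑ j, α i * α j * adjInd G i j * d j = ∑ i, α i * d i ^ 2 := by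
    rw [← h2, Finset.sum_comm]
    exact sum_congr rfl fun i _ => sum_congr rfl fun j _ => by rw [adjInd_comm]; ring
  have h4 : ∑ i, α i * (d i - 1 / 2) ^ 2 = ∑ i, α i * d i ^ 2 - density G α + 1 / 4 := by
    rw [density_eq_sum_wdeg, ← hd]
    have : ∀ i, α i * (d i - 1 / 2) ^ 2 = α i * d i ^ 2 - α i * d i + α i * (1 / 4) := by
      intro i; ring
    simp only [this, Finset.sum_add_distrib, Finset.sum_sub_distrib, ← Finset.sum_mul, hsum]
    ring
  simp only [mul_add, Finset.sum_add_distrib] at h1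
  rw [h2, h3] at h1
  linarith

theorem density_le_half (hG : G.CliqueFree 3) (hα : ∀ i, 0 ≤ α i) (hsum : ∑ i, α i = 1) :
    density G α ≤ 1 / 2 := by
  have := mantel_variance hG hα hsum
  have : 0 ≤ ∑ i, α i * (wdeg G α i - 1 / 2) ^ 2 :=
    sum_nonneg fun i _ => mul_nonneg (hα i) (sq_nonneg _)
  linarith

theorem wdeg_eq_half (hG : G.CliqueFree 3) (hα : ∀ i, 0 < α i) (hsum : ∑ i, α i = 1)
    (hd : density G α = 1 / 2) (i : V) : wdeg G α i = 1 / 2 := by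
  have h := mantel_variance hG (fun i => (hα i).le) hsum
  rw [hd, sub_self, mul_zero] at h
  have hnn : ∀ i ∈ univ, 0 ≤ α i * (wdeg G α i - 1 / 2) ^ 2 :=
    fun i _ => mul_nonneg (hα i).le (sq_nonneg _)
  have h0 := (sum_eq_zero_iff_of_nonneg hnn).1 (le_antisymm h (sum_nonneg hnn)) i (mem_univ i)
  have := (mul_eq_zero.1 h0).resolve_left (hα i).ne'
  linarith [pow_eq_zero_iff (two_ne_zero) |>.1 this]

/-- Neighbourhoods of adjacent vertices are disjoint and here have total weight 1; since all weights
are positive, no vertex escapes both. -/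
theorem adj_iff_not_adj_of_adj (hG : G.CliqueFree 3) (hα : ∀ i, 0 < α i) (hsum : ∑ i, α i = 1)
    (hd : ∀ i, wdeg G α i = 1 / 2) {i j : V} (h : G.Adj i j) (k : V) :
    G.Adj j k ↔ ¬ G.Adj i k := by
  refine ⟨fun h1 h2 => no_triangle hG h h2 h1, fun h1 => ?_⟩
  by_contra h2
  have hnn : ∀ k ∈ univ, 0 ≤ α k * (1 - adjInd G i k - adjInd G j k) := fun k _ =>
    mul_nonneg (hα k).le (by linarith [adjInd_add_le_one hG h k])
  have h0 : ∑ k, α k * (1 - adjInd G i k - adjInd G j k) = 0 := by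
    simp only [mul_sub, mul_one, Finset.sum_sub_distrib, hsum]
    have h1 := hd i
    have h2 := hd j
    rw [wdeg] at h1 h2
    linarith
  have := (sum_eq_zero_iff_of_nonneg hnn).1 h0 k (mem_univ k)
  rw [adjInd_of_not_adj h1, adjInd_of_not_adj h2] at this
  linarith [hα k]

/-- A triangle-free graph all of whose weighted degrees are `1/2` is complete bipartite, one of the
parts being the neighbourhood of any given vertex. -/
theorem adj_iff_separated (hG : G.CliqueFree 3) (hα : ∀ i, 0 < α i) (hsum : ∑ i, α i = 1)
    (hd : ∀ i, wdeg G α i = 1 / 2) (i j k : V) :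
    G.Adj j k ↔ ¬ (G.Adj i j ↔ G.Adj i k) := by
  by_cases hij : G.Adj i j
  · simpa [hij] using adj_iff_not_adj_of_adj hG hα hsum hd hij k
  obtain ⟨y, hy⟩ : ∃ y, G.Adj i y := by
    by_contra! h
    have := hd i
    simp [wdeg, adjInd, h] at this
  have h1 := adj_iff_not_adj_of_adj hG hα hsum hd hy j
  have h2 := adj_iff_not_adj_of_adj hG hα hsum hd hy k
  have h3 := adj_iff_not_adj_of_adj hG hα hsum hd (h1.2 hij).symm k
  tauto

/-- Two balanced complete bipartite graphs of codensity `1/4` are orthogonal: every vertex has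
common neighbourhood of weight `1/4`. -/
theorem codegree_eq_quarter (hG : ∀ i j k, G.Adj j k ↔ ¬ (G.Adj i j ↔ G.Adj i k))
    (hH : ∀ i j k, H.Adj j k ↔ ¬ (H.Adj i j ↔ H.Adj i k)) (hsum : ∑ i, α i = 1)
    (hdG : ∀ i, wdeg G α i = 1 / 2) (hdH : ∀ i, wdeg H α i = 1 / 2)
    (hp : coDensity G H α = 1 / 4) (i : V) :
    ∑ k, α k * (adjInd G i k * adjInd H i k) = 1 / 4 := by
  have hsgn : ∀ F : SimpleGraph V, (∀ i j k, F.Adj j k ↔ ¬ (F.Adj i j ↔ F.Adj i k)) →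
      ∀ j k, adjInd F j k = (1 - (1 - 2 * adjInd F i j) * (1 - 2 * adjInd F i k)) / 2 := by
    intro F hF j k
    have := hF i j k
    by_cases h1 : F.Adj i j <;> by_cases h2 : F.Adj i k <;> simp only [h1, h2] at this <;>
      norm_num [adjInd, h1, h2, this]
  -- Encode the cuts by ±1 vectors `s`, `t`: adjacency in the first is (1 - s j * s k) / 2. Both
  -- have mean 0, so the codensity is (1 + (∑ α s t)²) / 4, and the value 1/4 forces orthogonality.
  set s : V → ℝ := fun k => 1 - 2 * adjInd G i k with hs
  set t : V → ℝ := fun k => 1 - 2 * adjInd H i k with ht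
  have hs0 : ∑ k, α k * s k = 0 := by
    have h1 : ∀ k, α k * s k = α k - 2 * (α k * adjInd G i k) := fun k => by
      simp only [hs]; ring
    have h2 := hdG i
    rw [wdeg] at h2
    simp only [h1, Finset.sum_sub_distrib, ← Finset.mul_sum, hsum, h2]
    norm_num
  have ht0 : ∑ k, α k * t k = 0 := by
    have h1 : ∀ k, α k * t k = α k - 2 * (α k * adjInd H i k) := fun k => by
      simp only [ht]; ring
    have h2 := hdH i
    rw [wdeg] at h2
    simp only [h1, Finset.sum_sub_distrib, ← Finset.mul_sum, hsum, h2]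
    norm_num
  have hcod : coDensity G H α = ((∑ i, α i) * (∑ i, α i) - (∑ k, α k * s k) * (∑ k, α k * s k) -
      (∑ k, α k * t k) * (∑ k, α k * t k) +
      (∑ k, α k * (s k * t k)) * (∑ k, α k * (s k * t k))) / 4 := by
    simp only [Finset.sum_mul_sum, ← Finset.sum_sub_distrib, ← Finset.sum_add_distrib,
      Finset.sum_div]
    refine sum_congr rfl fun j _ => sum_congr rfl fun k _ => ?_
    rw [hsgn G hG j k, hsgn H hH j k]
    simp only [hs, ht]
    ring
  rw [hp, hsum, hs0, ht0] at hcod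
  have horth : ∑ k, α k * (s k * t k) = 0 := by
    have : (∑ k, α k * (s k * t k)) * (∑ k, α k * (s k * t k)) = 0 := by linarith
    exact mul_self_eq_zero.1 this
  have hlast : ∀ k, α k * (adjInd G i k * adjInd H i k) =
      (α k * (s k * t k) - α k * s k - α k * t k + α k) / 4 := fun k => by
    simp only [hs, ht]; ring
  simp only [hlast, ← Finset.sum_div, Finset.sum_add_distrib, Finset.sum_sub_distrib, horth, hs0,
    ht0, hsum]
  norm_num

end Mantel

/-! ### Recognising complete bipartite graphs. -/

section CompleteBipartite

/-- A graph given by separating two classes of `m` and `n` vertices is `K_{m,n}`. -/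
theorem nonempty_iso_completeBipartite {V : Type*} [Fintype V] (G : SimpleGraph V) (p : V → Prop)
    [DecidablePred p] (hG : ∀ j k, G.Adj j k ↔ ¬ (p j ↔ p k)) {m n : ℕ}
    (h1 : Fintype.card {x // p x} = m) (h2 : Fintype.card {x // ¬ p x} = n) :
    Nonempty (G ≃g completeBipartiteGraph (Fin m) (Fin n)) := by
  let e : V ≃ Fin m ⊕ Fin n := (Equiv.sumCompl p).symm.trans
    (Equiv.sumCongr (Fintype.equivFinOfCardEq h1) (Fintype.equivFinOfCardEq h2))
  have hl : ∀ x, (e x).isLeft = true ↔ p x := by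
    intro x
    by_cases hx : p x
    · simp [e, hx, Equiv.sumCompl_symm_apply_of_pos]
    · simp [e, hx, Equiv.sumCompl_symm_apply_of_neg]
  have hr : ∀ x, (e x).isRight = true ↔ ¬ p x := by
    intro x
    rw [← hl x]
    simp
  refine ⟨⟨e, fun {a b} => ?_⟩⟩
  rw [hG]
  simp only [completeBipartiteGraph, hl, hr]
  tauto

end CompleteBipartite

/-! ### The quadratic majorant of the logarithm. -/

section Logarithm

theorem logb_two_three_gt : 3 / 2 < Real.logb 2 3 := by
  rw [Real.lt_logb_iff_rpow_lt (by norm_num) (by norm_num)]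
  have : ((2 : ℝ) ^ (3 / 2 : ℝ)) ^ 2 < 3 ^ 2 := by
    rw [← Real.rpow_natCast, ← Real.rpow_mul (by norm_num)]
    norm_num
  exact lt_of_pow_lt_pow_left₀ 2 (by norm_num) this

theorem logb_two_three_lt : Real.logb 2 3 < 8 / 5 := by
  rw [Real.logb_lt_iff_lt_rpow (by norm_num) (by norm_num)]
  have : (3 : ℝ) ^ 5 < ((2 : ℝ) ^ (8 / 5 : ℝ)) ^ 5 := by
    rw [← Real.rpow_natCast (2 ^ (8 / 5 : ℝ)), ← Real.rpow_mul (by norm_num)]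
    norm_num
  exact lt_of_pow_lt_pow_left₀ 5 (by positivity) this

/-- This is 5³ · 3⁵ = 30375 < 2¹⁵, exactly what the majorant needs at 5. The bounds 3/2 and 8/5 on
log₂ 3 are what it needs at 2 and 6. -/
theorem three_logb_five_add_lt : 3 * Real.logb 2 5 + 5 * Real.logb 2 3 < 15 := by
  have h : Real.logb 2 ((5 : ℝ) ^ 3 * 3 ^ 5) < 15 := by
    rw [Real.logb_lt_iff_lt_rpow (by norm_num) (by norm_num)]
    norm_num
  rw [Real.logb_mul (by norm_num) (by norm_num), Real.logb_pow, Real.logb_pow] at h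
  exact_mod_cast h

/-- The linear coefficient of the quadratic interpolating `0, log₂ 3, log₂ 4` at `0, 3, 4`. -/
noncomputable def linCoeff : ℝ := 4 / 3 * Real.logb 2 3 - 3 / 2

/-- The leading coefficient of the quadratic interpolating `0, log₂ 3, log₂ 4` at `0, 3, 4`. -/
noncomputable def quadCoeff : ℝ := 1 / 2 - Real.logb 2 3 / 3

theorem logb_le_quadratic {n : ℕ} (hn : n ≤ 6) :
    Real.logb 2 n ≤ linCoeff * n + quadCoeff * n ^ 2 := by
  have h1 := logb_two_three_gt
  have h2 := logb_two_three_lt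
  have h3 := three_logb_five_add_lt
  have h4 : Real.logb 2 4 = 2 := by
    rw [show (4 : ℝ) = 2 ^ (2 : ℕ) by norm_num, Real.logb_pow]; simp
  have h6 : Real.logb 2 6 = 1 + Real.logb 2 3 := by
    rw [show (6 : ℝ) = 2 * 3 by norm_num, Real.logb_mul (by norm_num) (by norm_num)]; simp
  unfold linCoeff quadCoeff
  -- The case 0 relies on the default value `Real.logb 2 0 = 0`.
  interval_cases n <;> norm_num [h4, h6] <;> linarith

theorem eq_of_logb_eq_quadratic {n : ℕ} (hn : n ≤ 6) (hn2 : 2 ≤ n)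
    (h : Real.logb 2 n = linCoeff * n + quadCoeff * n ^ 2) : n = 3 ∨ n = 4 := by
  have h1 := logb_two_three_gt
  have h2 := logb_two_three_lt
  have h3 := three_logb_five_add_lt
  have h6 : Real.logb 2 6 = 1 + Real.logb 2 3 := by
    rw [show (6 : ℝ) = 2 * 3 by norm_num, Real.logb_mul (by norm_num) (by norm_num)]; simp
  unfold linCoeff quadCoeff at h
  interval_cases n
  · norm_num at h; linarith
  · simp
  · simp
  · norm_num at h; linarith
  · norm_num [h6] at h; linarith

end Logarithm

end ErdosRothschild

namespace ErdosRothschild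

open Finset

/-! ### Moments of the multiplicity. -/

namespace Triple

variable {s : ℕ}

/-- The number of colours of a pair, `0` on the diagonal. -/
def mult (T : Triple s) (i j : Fin T.r) : ℕ := if i = j then 0 else (T.φ s(i, j)).card

theorem mult_self (T : Triple s) (i : Fin T.r) : T.mult i i = 0 := by simp [mult]

theorem mult_of_ne (T : Triple s) {i j : Fin T.r} (h : i ≠ j) :
    T.mult i j = (T.φ s(i, j)).card := by simp [mult, h]

theorem mult_comm (T : Triple s) (i j : Fin T.r) : T.mult i j = T.mult j i := by
  simp only [mult, eq_comm (a := i), Sym2.eq_swap (a := i)]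

theorem mult_le (T : Triple s) (i j : Fin T.r) : T.mult i j ≤ s := by
  unfold mult
  split_ifs
  · exact Nat.zero_le _
  · simpa using card_le_univ (T.φ s(i, j))

theorem colourGraph_adj (T : Triple s) (c : Fin s) (i j : Fin T.r) :
    (T.colourGraph c).Adj i j ↔ c ∈ T.φ s(i, j) ∧ i ≠ j := by
  simp [colourGraph]

theorem multiplicityGraph_adj (T : Triple s) {t : ℕ} (ht : t ≠ 0) (i j : Fin T.r) :
    (T.multiplicityGraph t).Adj i j ↔ T.mult i j = t := by
  rcases eq_or_ne i j with rfl | h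
  · simp [T.mult_self, ht.symm]
  · simp [multiplicityGraph, T.mult_of_ne h, h]

theorem sum_adjInd (T : Triple s) (i j : Fin T.r) :
    ∑ c, adjInd (T.colourGraph c) i j = T.mult i j := by
  classical
  by_cases h : i = j
  · subst h
    simp [mult_self, adjInd]
  · simp [mult_of_ne T h, adjInd, colourGraph_adj, h]

theorem q_eq_sum_mult (T : Triple s) :
    T.q = ∑ i, ∑ j, T.α i * T.α j * Real.logb 2 (T.mult i j) := by
  set f : Fin T.r → Fin T.r → ℝ := fun i j => T.α i * T.α j * Real.logb 2 (T.mult i j) with hf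
  have hcomm : ∀ i j, f i j = f j i := fun i j => by simp only [hf, mult_comm T i j]; ring
  have hlt : T.q = 2 * ∑ i, ∑ j, if i < j then f i j else 0 := by
    simp only [q, Finset.sum_filter]
    congr 1
    refine sum_congr rfl fun i _ => sum_congr rfl fun j _ => ?_
    split_ifs with h
    · simp only [hf, mult_of_ne T h.ne]
    · rfl
  have hgt : ∑ i, ∑ j, (if i < j then f i j else 0) = ∑ i, ∑ j, if j < i then f i j else 0 := by
    rw [Finset.sum_comm]
    exact sum_congr rfl fun i _ => sum_congr rfl fun j _ => by rw [hcomm]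
  rw [hlt, two_mul]
  nth_rewrite 2 [hgt]
  simp only [← Finset.sum_add_distrib]
  refine sum_congr rfl fun i _ => sum_congr rfl fun j _ => ?_
  rcases lt_trichotomy i j with h | rfl | h
  · simp [h, h.not_gt, hf]
  · simp [mult_self]
  · simp [h, h.not_gt, hf]

theorem sum_mult (T : Triple s) :
    ∑ i, ∑ j, T.α i * T.α j * (T.mult i j : ℝ) = ∑ c, density (T.colourGraph c) T.α := by
  simp only [← sum_adjInd, Finset.mul_sum, density]
  conv_rhs => rw [Finset.sum_comm]
  exact sum_congr rfl fun i _ => Finset.sum_comm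

theorem sum_mult_sq (T : Triple s) :
    ∑ i, ∑ j, T.α i * T.α j * (T.mult i j : ℝ) ^ 2 =
      ∑ c, ∑ d, coDensity (T.colourGraph c) (T.colourGraph d) T.α := by
  simp only [← sum_adjInd, sq, Finset.sum_mul_sum]
  simp only [Finset.mul_sum, coDensity]
  symm
  calc _ = ∑ c, ∑ i, ∑ d, ∑ j, T.α i * T.α j *
        (adjInd (T.colourGraph c) i j * adjInd (T.colourGraph d) i j) :=
        sum_congr rfl fun c _ => Finset.sum_comm
    _ = ∑ i, ∑ c, ∑ j, ∑ d, T.α i * T.α j *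
        (adjInd (T.colourGraph c) i j * adjInd (T.colourGraph d) i j) := by
        rw [Finset.sum_comm]
        exact sum_congr rfl fun i _ => sum_congr rfl fun c _ => Finset.sum_comm
    _ = _ := sum_congr rfl fun i _ => Finset.sum_comm

end Triple

/-! ### The upper bound and the structure of the extremal triples. -/

variable {T : Triple 6}

/-- The deficit of a feasible triple from the extremal value, as a sum of three terms. -/
theorem deficit_eq (T : Triple 6) :
    1 / 2 * Real.logb 2 3 + 3 / 4 - T.q =
      ∑ i, ∑ j, T.α i * T.α j *
        (linCoeff * T.mult i j + quadCoeff * (T.mult i j : ℝ) ^ 2 - Real.logb 2 (T.mult i j)) +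
      (-quadCoeff) * ∑ c, ∑ d ∈ univ.erase c, (coDensity (T.colourGraph c) (T.colourGraph d) T.α -
        (5 / 4 * (density (T.colourGraph c) T.α + density (T.colourGraph d) T.α) - 1)) +
      (linCoeff + 27 / 2 * quadCoeff) * ∑ c, (1 / 2 - density (T.colourGraph c) T.α) := by
  have h1 : ∑ i, ∑ j, T.α i * T.α j *
        (linCoeff * T.mult i j + quadCoeff * (T.mult i j : ℝ) ^ 2 - Real.logb 2 (T.mult i j)) =
      linCoeff * ∑ i, ∑ j, T.α i * T.α j * (T.mult i j : ℝ) +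
      quadCoeff * ∑ i, ∑ j, T.α i * T.α j * (T.mult i j : ℝ) ^ 2 - T.q := by
    rw [T.q_eq_sum_mult]
    simp only [Finset.mul_sum, ← Finset.sum_add_distrib, ← Finset.sum_sub_distrib]
    exact sum_congr rfl fun i _ => sum_congr rfl fun j _ => by ring
  rw [h1, T.sum_mult, T.sum_mult_sq]
  have h2 : ∀ c : Fin 6, ∑ d ∈ univ.erase c,
      (coDensity (T.colourGraph c) (T.colourGraph d) T.α -
        (5 / 4 * (density (T.colourGraph c) T.α + density (T.colourGraph d) T.α) - 1)) =
      ∑ d, coDensity (T.colourGraph c) (T.colourGraph d) T.α -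
        6 * density (T.colourGraph c) T.α - 5 / 4 * ∑ d, density (T.colourGraph d) T.α + 5 := by
    intro c
    rw [Finset.sum_erase_eq_sub (mem_univ c), coDensity_self]
    simp only [Finset.sum_sub_distrib, ← Finset.mul_sum, Finset.sum_add_distrib]
    simp
    ring
  simp only [h2, Finset.sum_add_distrib, Finset.sum_sub_distrib, ← Finset.mul_sum]
  simp only [sum_const, card_univ, Fintype.card_fin, nsmul_eq_mul]
  unfold linCoeff quadCoeff
  push_cast
  ring

theorem quadCoeff_neg : quadCoeff < 0 := by
  have := logb_two_three_gt
  unfold quadCoeff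
  linarith

/-- In 27/2 = 1 + 25/2, the 1 comes from the codensity of a colour with itself, and 25/2 = 2 · 5 ·
5/4 from its ordered pairs with the other five colours. -/
theorem linCoeff_add_quadCoeff_pos : 0 < linCoeff + 27 / 2 * quadCoeff := by
  have := logb_two_three_lt
  unfold linCoeff quadCoeff
  linarith

section Bound

variable (hT : T ∈ feas (fun _ : Fin 6 => 3))

include hT

theorem quadratic_slack_nonneg (i j : Fin T.r) : 0 ≤ T.α i * T.α j *
    (linCoeff * T.mult i j + quadCoeff * (T.mult i j : ℝ) ^ 2 - Real.logb 2 (T.mult i j)) :=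
  mul_nonneg (mul_nonneg (hT.weight_pos i).le (hT.weight_pos j).le)
    (sub_nonneg.2 (logb_le_quadratic (T.mult_le i j)))

theorem coDensity_slack_nonneg (c d : Fin 6) :
    0 ≤ coDensity (T.colourGraph c) (T.colourGraph d) T.α -
        (5 / 4 * (density (T.colourGraph c) T.α + density (T.colourGraph d) T.α) - 1) :=
  sub_nonneg.2 (coDensity_lower (hT.cliqueFree c) (hT.cliqueFree d)
    (fun i => (hT.weight_pos i).le) hT.weight_sum)

theorem density_slack_nonneg (c : Fin 6) : 0 ≤ 1 / 2 - density (T.colourGraph c) T.α :=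
  sub_nonneg.2 (density_le_half (hT.cliqueFree c) (fun i => (hT.weight_pos i).le) hT.weight_sum)

theorem q_le : T.q ≤ 1 / 2 * Real.logb 2 3 + 3 / 4 := by
  rw [← sub_nonneg, deficit_eq]
  exact add_nonneg (add_nonneg
    (sum_nonneg fun i _ => sum_nonneg fun j _ => quadratic_slack_nonneg hT i j)
    (mul_nonneg (neg_nonneg.2 quadCoeff_neg.le)
      (sum_nonneg fun c _ => sum_nonneg fun d _ => coDensity_slack_nonneg hT c d)))
    (mul_nonneg linCoeff_add_quadCoeff_pos.le (sum_nonneg fun c _ => density_slack_nonneg hT c))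

variable (hq : T.q = 1 / 2 * Real.logb 2 3 + 3 / 4)

include hq

theorem slacks_eq_zero :
    (∀ i j, T.α i * T.α j * (linCoeff * T.mult i j + quadCoeff * (T.mult i j : ℝ) ^ 2 -
      Real.logb 2 (T.mult i j)) = 0) ∧
    (∀ c d, c ≠ d → coDensity (T.colourGraph c) (T.colourGraph d) T.α -
        (5 / 4 * (density (T.colourGraph c) T.α + density (T.colourGraph d) T.α) - 1) = 0) ∧
    ∀ c, 1 / 2 - density (T.colourGraph c) T.α = 0 := by
  have h := deficit_eq T
  rw [hq, sub_self] at h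
  have hrow : ∀ i ∈ univ, 0 ≤ ∑ j, T.α i * T.α j * (linCoeff * T.mult i j +
      quadCoeff * (T.mult i j : ℝ) ^ 2 - Real.logb 2 (T.mult i j)) := fun i _ =>
    sum_nonneg fun j _ => quadratic_slack_nonneg hT i j
  have hcol : ∀ c ∈ univ, 0 ≤ ∑ d ∈ univ.erase c,
      (coDensity (T.colourGraph c) (T.colourGraph d) T.α -
        (5 / 4 * (density (T.colourGraph c) T.α + density (T.colourGraph d) T.α) - 1)) :=
    fun c _ => sum_nonneg fun d _ => coDensity_slack_nonneg hT c d
  have hden : ∀ c ∈ univ, 0 ≤ 1 / 2 - density (T.colourGraph c) T.α :=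
    fun c _ => density_slack_nonneg hT c
  have h1 := sum_nonneg hrow
  have h2 := mul_nonneg (neg_nonneg.2 quadCoeff_neg.le) (sum_nonneg hcol)
  have h3 := mul_nonneg linCoeff_add_quadCoeff_pos.le (sum_nonneg hden)
  refine ⟨fun i j => ?_, fun c d hcd => ?_, fun c => ?_⟩
  · have h0 := (sum_eq_zero_iff_of_nonneg hrow).1 (by linarith) i (mem_univ i)
    exact (sum_eq_zero_iff_of_nonneg fun j _ => quadratic_slack_nonneg hT i j).1 h0 j (mem_univ j)
  · have h0 := (mul_eq_zero.1 (le_antisymm (by linarith) h2)).resolve_left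
      (neg_ne_zero.2 quadCoeff_neg.ne)
    have h0' := (sum_eq_zero_iff_of_nonneg hcol).1 h0 c (mem_univ c)
    exact (sum_eq_zero_iff_of_nonneg fun d _ => coDensity_slack_nonneg hT c d).1 h0' d
      (mem_erase.2 ⟨hcd.symm, mem_univ d⟩)
  · have h0 := (mul_eq_zero.1 (le_antisymm (by linarith) h3)).resolve_left
      linCoeff_add_quadCoeff_pos.ne'
    exact (sum_eq_zero_iff_of_nonneg hden).1 h0 c (mem_univ c)

theorem mult_eq_three_or_four {i j : Fin T.r} (hij : i ≠ j) : T.mult i j = 3 ∨ T.mult i j = 4 := by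
  have h := (slacks_eq_zero hT hq).1 i j
  have h' := (mul_eq_zero.1 h).resolve_left
    (mul_pos (hT.weight_pos i) (hT.weight_pos j)).ne'
  refine eq_of_logb_eq_quadratic (T.mult_le i j) ?_ (by linarith)
  rw [T.mult_of_ne hij]
  exact hT.two_le_card i j hij

theorem wdeg_colourGraph (c : Fin 6) (i : Fin T.r) : wdeg (T.colourGraph c) T.α i = 1 / 2 :=
  wdeg_eq_half (hT.cliqueFree c) hT.weight_pos hT.weight_sum
    (by linarith [(slacks_eq_zero hT hq).2.2 c]) i

theorem colourGraph_adj_iff (c : Fin 6) (i j k : Fin T.r) : (T.colourGraph c).Adj j k ↔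
    ¬ ((T.colourGraph c).Adj i j ↔ (T.colourGraph c).Adj i k) :=
  adj_iff_separated (hT.cliqueFree c) hT.weight_pos hT.weight_sum (wdeg_colourGraph hT hq c) i j k

theorem codegree_colourGraph {c d : Fin 6} (hcd : c ≠ d) (i : Fin T.r) :
    ∑ k, T.α k * (adjInd (T.colourGraph c) i k * adjInd (T.colourGraph d) i k) = 1 / 4 := by
  obtain ⟨-, h2, h3⟩ := slacks_eq_zero hT hq
  exact codegree_eq_quarter (colourGraph_adj_iff hT hq c) (colourGraph_adj_iff hT hq d)
    hT.weight_sum (wdeg_colourGraph hT hq c) (wdeg_colourGraph hT hq d)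
    (by linarith [h2 c d hcd, h3 c, h3 d]) i

theorem sum_row_mult (i : Fin T.r) : ∑ k, T.α k * (T.mult i k : ℝ) = 3 := by
  simp only [← Triple.sum_adjInd, Finset.mul_sum]
  rw [Finset.sum_comm]
  have h : ∀ c, ∑ k, T.α k * adjInd (T.colourGraph c) i k = 1 / 2 := fun c =>
    wdeg_colourGraph hT hq c i
  simp only [h]
  norm_num

/-- Six diagonal terms 1/2 and thirty off-diagonal terms 1/4. -/
theorem sum_row_mult_sq (i : Fin T.r) : ∑ k, T.α k * (T.mult i k : ℝ) ^ 2 = 21 / 2 := by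
  have hcd : ∀ c d, ∑ k, T.α k * (adjInd (T.colourGraph c) i k * adjInd (T.colourGraph d) i k) =
      1 / 4 + if c = d then 1 / 4 else 0 := by
    intro c d
    split_ifs with h
    · subst h
      have h := wdeg_colourGraph hT hq c i
      rw [wdeg] at h
      have h' : ∀ k, adjInd (T.colourGraph c) i k * adjInd (T.colourGraph c) i k =
          adjInd (T.colourGraph c) i k := fun k => by
        by_cases h : (T.colourGraph c).Adj i k <;> simp [adjInd, h]
      simp only [h', h]
      norm_num
    · rw [codegree_colourGraph hT hq h, add_zero]
  have : ∀ k, T.α k * (T.mult i k : ℝ) ^ 2 = ∑ c, ∑ d,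
      T.α k * (adjInd (T.colourGraph c) i k * adjInd (T.colourGraph d) i k) := by
    intro k
    rw [← Triple.sum_adjInd, sq, Finset.sum_mul_sum, Finset.mul_sum]
    simp only [Finset.mul_sum]
  simp only [this]
  rw [Finset.sum_comm]
  have hin : ∀ c, ∑ k, ∑ d, T.α k *
      (adjInd (T.colourGraph c) i k * adjInd (T.colourGraph d) i k) = 7 / 4 := by
    intro c
    rw [Finset.sum_comm]
    simp only [hcd, Finset.sum_add_distrib]
    simp
    norm_num
  simp only [hin]
  norm_num

/-- Average (m - 3)(m - 4) over the row of `i`: only the diagonal entry m = 0 survives, giving 12 `α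
i`, while the moments give 21/2 - 21 + 12 = 3/2. -/
theorem weight_eq (i : Fin T.r) : T.α i = 1 / 8 := by
  have h : ∑ k, T.α k * ((T.mult i k : ℝ) - 3) * ((T.mult i k : ℝ) - 4) = 12 * T.α i := by
    rw [Finset.sum_eq_single i]
    · rw [T.mult_self]; push_cast; ring
    · intro k _ hk
      rcases mult_eq_three_or_four hT hq hk.symm with h | h <;> rw [h] <;> norm_num
    · simp
  have h' : ∀ k, T.α k * ((T.mult i k : ℝ) - 3) * ((T.mult i k : ℝ) - 4) =
      T.α k * (T.mult i k : ℝ) ^ 2 - 7 * (T.α k * (T.mult i k : ℝ)) + 12 * T.α k := fun k => by ring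
  simp only [h', Finset.sum_add_distrib, Finset.sum_sub_distrib, ← Finset.mul_sum,
    sum_row_mult hT hq, sum_row_mult_sq hT hq, hT.weight_sum] at h
  linarith

theorem r_eq : T.r = 8 := by
  have h := hT.weight_sum
  simp only [weight_eq hT hq, sum_const, card_univ, Fintype.card_fin, nsmul_eq_mul] at h
  have : (T.r : ℝ) = 8 := by linarith
  exact_mod_cast this

theorem card_subtype_eq_four (p : Fin T.r → Prop) [DecidablePred p]
    (hp : ∑ k, T.α k * (if p k then (1 : ℝ) else 0) = 1 / 2) :
    Fintype.card {x // p x} = 4 ∧ Fintype.card {x // ¬ p x} = 4 := by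
  simp only [weight_eq hT hq, ← Finset.mul_sum, Finset.sum_boole] at hp
  have h1 : (#{x | p x} : ℝ) = 4 := by linarith
  have h2 : Fintype.card {x // p x} = 4 := by
    rw [Fintype.card_subtype]; exact_mod_cast h1
  refine ⟨h2, ?_⟩
  rw [Fintype.card_subtype_compl, h2, Fintype.card_fin, r_eq hT hq]

theorem colourGraph_iso (c : Fin 6) :
    Nonempty (T.colourGraph c ≃g completeBipartiteGraph (Fin 4) (Fin 4)) := by
  classical
  obtain ⟨i⟩ : Nonempty (Fin T.r) := ⟨⟨0, by rw [r_eq hT hq]; norm_num⟩⟩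
  obtain ⟨h1, h2⟩ := card_subtype_eq_four hT hq (fun k => (T.colourGraph c).Adj i k) (by
    simpa only [wdeg, adjInd] using wdeg_colourGraph hT hq c i)
  exact nonempty_iso_completeBipartite _ _ (colourGraph_adj_iff hT hq c i) h1 h2

/-- Every colour meets a triangle in an even number of edges. -/
theorem even_mult_add (i j k : Fin T.r) : Even (T.mult i j + T.mult i k + T.mult j k) := by
  classical
  have hcount : ∀ i j, T.mult i j = ∑ c, if (T.colourGraph c).Adj i j then 1 else 0 := by
    intro i j
    have := T.sum_adjInd i j
    simp only [adjInd] at this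
    exact_mod_cast this.symm
  rw [hcount, hcount, hcount, ← Finset.sum_add_distrib, ← Finset.sum_add_distrib]
  refine Finset.even_sum _ fun c _ => ?_
  have := colourGraph_adj_iff hT hq c i j k
  by_cases h1 : (T.colourGraph c).Adj i j <;> by_cases h2 : (T.colourGraph c).Adj i k <;>
    by_cases h3 : (T.colourGraph c).Adj j k <;> simp_all

theorem multiplicityGraph_iso :
    Nonempty (T.multiplicityGraph 3 ≃g completeBipartiteGraph (Fin 4) (Fin 4)) := by
  classical
  obtain ⟨i⟩ : Nonempty (Fin T.r) := ⟨⟨0, by rw [r_eq hT hq]; norm_num⟩⟩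
  have hval : ∀ j k, T.mult j k = 0 ∨ T.mult j k = 3 ∨ T.mult j k = 4 := by
    intro j k
    rcases eq_or_ne j k with rfl | h
    · exact Or.inl (T.mult_self j)
    · exact Or.inr (mult_eq_three_or_four hT hq h)
  obtain ⟨h1, h2⟩ := card_subtype_eq_four hT hq (fun k => T.mult i k = 3) (by
    -- The polynomial (4m - m²)/3 is 0, 1, 0 at m = 0, 3, 4.
    have h : ∀ k, T.α k * (if T.mult i k = 3 then (1 : ℝ) else 0) =
        4 / 3 * (T.α k * (T.mult i k : ℝ)) - 1 / 3 * (T.α k * (T.mult i k : ℝ) ^ 2) := by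
      intro k
      rcases hval i k with h | h | h <;> simp [h] <;> ring
    simp only [h, Finset.sum_sub_distrib, ← Finset.mul_sum, sum_row_mult hT hq,
      sum_row_mult_sq hT hq]
    norm_num)
  refine nonempty_iso_completeBipartite _ _ (fun j k => ?_) h1 h2
  rw [T.multiplicityGraph_adj (by norm_num)]
  -- Among 0, 3, 4 only 3 is odd, so evenness on triangles says that the multiplicity-3 graph is a
  -- cut.
  have he := even_mult_add hT hq i j k
  rw [Nat.even_iff] at he
  rcases hval i j with h | h | h <;> rcases hval i k with h' | h' | h' <;>
    rcases hval j k with h'' | h'' | h'' <;> rw [h, h', h''] at he ⊢ <;> simp at he ⊢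

end Bound

/-! ### The extremal example from a binary code. -/

section Construction

/-- The codewords of a `[6, 3, 3]` binary linear code. -/
def codeword (i : Fin 8) : Fin 6 → Bool :=
  ![i.val.testBit 0, i.val.testBit 1, i.val.testBit 2,
    xor (i.val.testBit 0) (i.val.testBit 1), xor (i.val.testBit 0) (i.val.testBit 2),
    xor (i.val.testBit 1) (i.val.testBit 2)]

/-- The uniformly weighted triple on the codewords, a pair receiving the coordinates in which its
members differ. -/
noncomputable def codeTriple : Triple 6 where
  r := 8
  φ := Sym2.lift ⟨fun i j => {c | codeword i c ≠ codeword j c}, fun i j => by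
    simp only [ne_comm]⟩
  α := fun _ => 1 / 8

theorem codeTriple_mem_feas : codeTriple ∈ feas (fun _ : Fin 6 => 3) where
  cliqueFree c := by
    intro t ht
    obtain ⟨x, y, z, hxy, hxz, hyz, -⟩ := SimpleGraph.is3Clique_iff.1 ht
    have hx : codeword x c ≠ codeword y c := by
      exact (mem_filter.1 ((codeTriple.colourGraph_adj c x y).1 hxy).1).2
    have hy : codeword x c ≠ codeword z c := by
      exact (mem_filter.1 ((codeTriple.colourGraph_adj c x z).1 hxz).1).2
    have hz : codeword y c ≠ codeword z c := by
      exact (mem_filter.1 ((codeTriple.colourGraph_adj c y z).1 hyz).1).2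
    revert hx hy hz
    -- Three bits cannot be pairwise distinct.
    generalize codeword x c = a, codeword y c = b, codeword z c = d
    revert a b d
    decide
  two_le_card := by
    change ∀ i j : Fin 8, i ≠ j → 2 ≤ #{c | codeword i c ≠ codeword j c}
    decide
  weight_pos _ := by simp [codeTriple]
  weight_sum := by
    change ∑ _i : Fin 8, (1 / 8 : ℝ) = 1
    norm_num

theorem codeTriple_q : codeTriple.q = 1 / 2 * Real.logb 2 3 + 3 / 4 := by
  set d : Fin 8 → Fin 8 → ℕ := fun i j => #{c | codeword i c ≠ codeword j c} with hd
  have hmult : ∀ i j : Fin 8, codeTriple.mult i j = d i j := by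
    intro i j
    rcases eq_or_ne i j with rfl | h
    · exact (codeTriple.mult_self i).trans (by simp [hd])
    · exact codeTriple.mult_of_ne h
  -- Each codeword has four others at distance 3 and three at distance 4.
  have hval : ∀ i j, d i j = 0 ∨ d i j = 3 ∨ d i j = 4 := by decide
  have h3 : ∀ i, #{j | d i j = 3} = 4 := by decide
  have h4 : ∀ i, #{j | d i j = 4} = 3 := by decide
  have hlog : ∀ i j, Real.logb 2 (d i j) =
      Real.logb 2 3 * (if d i j = 3 then 1 else 0) + 2 * (if d i j = 4 then 1 else 0) := by
    intro i j
    have h4 : Real.logb 2 4 = 2 := by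
      rw [show (4 : ℝ) = 2 ^ (2 : ℕ) by norm_num, Real.logb_pow]; simp
    rcases hval i j with h | h | h <;> simp [h, h4]
  rw [Triple.q_eq_sum_mult]
  change ∑ i : Fin 8, ∑ j : Fin 8, (1 / 8 : ℝ) * (1 / 8) * Real.logb 2 (codeTriple.mult i j) = _
  simp only [hmult, hlog, ← Finset.mul_sum, Finset.sum_add_distrib, Finset.sum_boole, h3, h4]
  simp
  ring

end Construction

end ErdosRothschild

theorem mainTheorem8 :
    IsGreatest (ErdosRothschild.Triple.q '' ErdosRothschild.feas (fun _ : Fin 6 => 3))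
      (1 / 2 * Real.logb 2 3 + 3 / 4) ∧
    ∀ T ∈ ErdosRothschild.opt (fun _ : Fin 6 => 3),
      T.r = 8 ∧
      (∀ i, T.α i = 1 / 8) ∧
      (∀ i j, i ≠ j → (T.φ s(i, j)).card = 3 ∨ (T.φ s(i, j)).card = 4) ∧
      Nonempty (T.multiplicityGraph 3 ≃g completeBipartiteGraph (Fin 4) (Fin 4)) ∧
      ∀ c, Nonempty (T.colourGraph c ≃g completeBipartiteGraph (Fin 4) (Fin 4)) := by
  refine ⟨⟨⟨_, ErdosRothschild.codeTriple_mem_feas, ErdosRothschild.codeTriple_q⟩, ?_⟩, ?_⟩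
  · rintro _ ⟨T, hT, rfl⟩
    exact ErdosRothschild.q_le hT
  · rintro T ⟨hT, hmax⟩
    have hq : T.q = 1 / 2 * Real.logb 2 3 + 3 / 4 :=
      le_antisymm (ErdosRothschild.q_le hT)
        (ErdosRothschild.codeTriple_q ▸ hmax _ ErdosRothschild.codeTriple_mem_feas)
    refine ⟨ErdosRothschild.r_eq hT hq, ErdosRothschild.weight_eq hT hq, fun i j hij => ?_,
      ErdosRothschild.multiplicityGraph_iso hT hq, ErdosRothschild.colourGraph_iso hT hq⟩
    rw [← T.mult_of_ne hij]
    exact ErdosRothschild.mult_eq_three_or_four hT hq hij
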